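/- For an array $Y\in\mathbb{R}^{I\times J\times K}$ let $\operatorname{rank}_\circ(Y)$ be the least $R$ such that $Y$ is a sum of $R$ outer products $x_r\circ y_r\circ z_r$ with $x_r\in\mathbb{R}^I$, $y_r\in\mathbb{R}^J$, $z_r\in\mathbb{R}^K$, and let $S_R(I,J,K)=\{Y\in\mathbb{R}^{I\times J\times K} : \operatorname{rank}_\circ(Y)\le R\}$. Interior, boundary and exterior points of this set are taken in $\mathbb{R}^{I\times J\times K}$ with its usual topology (that of the Frobenius norm); an exterior point is an interior point of the complement. For $Y\in\mathbb{R}^{I\times I\times 2}$ and a real $2\times 2$ matrix $U=(u_{kl})$, let $X=(\mathbf{I}_I,\mathbf{I}_I,U)\cdot Y$ be the array with frontal slices $X_k=u_{k1}Y_1+u_{k2}Y_2$ $(k=1,2)$, where $Y_1,Y_2$ are the frontal $I\times I$ slices of $Y$. Eigenvalues are counted with algebraic multiplicity. Let $Y\in\mathbb{R}^{I\times I\times 2}$. (a) Suppose that $U$ is nonsingular and that $X=(\mathbf{I}_I,\mathbf{I}_I,U)\cdot Y$ has nonsingular first slice $X_1$. Then: (a1) $Y$ is an interior point of $S_I(I,I,2)$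 if $X_2X_1^{-1}$ has $I$ distinct real eigenvalues; (a2) $Y$ is a boundary point of $S_I(I,I,2)$ if $X_2X_1^{-1}$ has $I$ real eigenvalues that are not all distinct; (a3) $Y$ is an exterior point of $S_I(I,I,2)$ if $X_2X_1^{-1}$ has at least one pair of complex conjugate non-real eigenvalues. (b) Suppose that $I\ge 2$ and that there is no nonsingular $U$ for which $X=(\mathbf{I}_I,\mathbf{I}_I,U)\cdot Y$ has nonsingular first slice $X_1$. Then $Y$ is a boundary point of $S_I(I,I,2)$. -/

import Mathlib

/-- Real `I × J × K` arrays. The topology is the product topology, which is the one of the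
Frobenius norm (the space is finite-dimensional). -/
abbrev RealArray (I J K : ℕ) : Type := Fin I → Fin J → Fin K → ℝ

namespace RealArray

/-- The outer product `x ∘ y ∘ z` of three vectors. -/
def outer {I J K : ℕ} (x : Fin I → ℝ) (y : Fin J → ℝ) (z : Fin K → ℝ) : RealArray I J K :=
  fun i j k => x i * y j * z k

/-- `Y` is a sum of `R` outer products. -/
def IsSumOfOuter {I J K : ℕ} (Y : RealArray I J K) (R : ℕ) : Prop :=
  ∃ (x : Fin R → Fin I → ℝ) (y : Fin R → Fin J → ℝ) (z : Fin R → Fin K → ℝ),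
    Y = ∑ r, outer (x r) (y r) (z r)

/-- The outer-product rank: the least `R` such that `Y` is a sum of `R` outer products. -/
noncomputable def outerRank {I J K : ℕ} (Y : RealArray I J K) : ℕ :=
  sInf {R : ℕ | IsSumOfOuter Y R}

/-- Every array is a sum of finitely many outer products, so the minimum is attained. -/
theorem exists_isSumOfOuter {I J K : ℕ} (Y : RealArray I J K) :
    {R : ℕ | IsSumOfOuter Y R}.Nonempty := by
  classical
  let e := Fintype.equivFin (Fin I × Fin J × Fin K)
  refine ⟨Fintype.card (Fin I × Fin J × Fin K),
    fun r => Pi.single (e.symm r).1 (Y (e.symm r).1 (e.symm r).2.1 (e.symm r).2.2),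
    fun r => Pi.single (e.symm r).2.1 1, fun r => Pi.single (e.symm r).2.2 1, ?_⟩
  rw [Equiv.sum_comp e.symm (fun p : Fin I × Fin J × Fin K =>
    outer (Pi.single p.1 (Y p.1 p.2.1 p.2.2)) (Pi.single p.2.1 1) (Pi.single p.2.2 1))]
  funext i j k
  simp [Finset.sum_apply, outer, Fintype.sum_prod_type, Pi.single_apply]

/-- The set `S_R(I,J,K)` of arrays of outer-product rank at most `R`. -/
def rankSet (R I J K : ℕ) : Set (RealArray I J K) := {Y | outerRank Y ≤ R}

/-- The multilinear matrix multiplication `(S, T, U) · Y`. -/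
def mulMat {I J K I' J' K' : ℕ} (S : Matrix (Fin I') (Fin I) ℝ) (T : Matrix (Fin J') (Fin J) ℝ)
    (U : Matrix (Fin K') (Fin K) ℝ) (Y : RealArray I J K) : RealArray I' J' K' :=
  fun i j k => ∑ a, ∑ b, ∑ c, S i a * T j b * U k c * Y a b c

/-- The `k`-th frontal slice (counted from `0`). -/
def slice {I J K : ℕ} (Y : RealArray I J K) (k : Fin K) : Matrix (Fin I) (Fin J) ℝ :=
  Matrix.of fun i j => Y i j k

/-- The multilinear product `(1, 1, U) · Y`; it is called a slicemix when `U` is nonsingular. -/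
def mix {I J K : ℕ} (U : Matrix (Fin K) (Fin K) ℝ) (Y : RealArray I J K) : RealArray I J K :=
  mulMat 1 1 U Y

/-- The eigenvalues in `ℂ` of a real square matrix, with algebraic multiplicity. -/
noncomputable def eigs {n : ℕ} (M : Matrix (Fin n) (Fin n) ℝ) : Multiset ℂ :=
  (M.map (algebraMap ℝ ℂ)).charpoly.roots

/-- `Y` is an interior point of `A`. -/
def IsInteriorPoint {I J K : ℕ} (A : Set (RealArray I J K)) (Y : RealArray I J K) : Prop :=
  Y ∈ interior A

/-- `Y` is a boundary point of `A`: it lies in the closure of `A` and in that of its complement. -/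
def IsBoundaryPoint {I J K : ℕ} (A : Set (RealArray I J K)) (Y : RealArray I J K) : Prop :=
  Y ∈ frontier A

/-- `Y` is an exterior point of `A`: an interior point of the complement. -/
def IsExteriorPoint {I J K : ℕ} (A : Set (RealArray I J K)) (Y : RealArray I J K) : Prop :=
  Y ∈ interior Aᶜ

end RealArray

/-! A sum of `I` outer products is exactly an array whose slices are `P diag(c) Q` and `P diag(d)
Q`. Slicemixing by a nonsingular `U` is a homeomorphism that preserves this form, so everything
reduces to the topology of `diagonalPencils` at a pencil `(A, B)`, read off from `det (s A - B)`.

Distinct real roots give sign changes that survive small perturbations, hence an interior point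
(`mem_interior_of_distinct_roots`). Diagonal pencils satisfy the closed inequality `|Im z|^n |det A|
≤ ‖det (z A - B)‖`, which fails at a non-real root when `det A ≠ 0`, hence an exterior point
(`notMem_closure_of_nonreal_root`).

For boundary points, a pencil with real spectrum, or with `det (s A - B)` identically zero, is
equivalent to a triangular one (`triangularizable_of_splits`), and moving the diagonals makes the
eigenvalues distinct. Conversely a double real eigenvalue can be split into a non-real pair
(`mem_closure_compl_of_rootMultiplicity`), and a singular pencil is a limit of regular ones with a
double eigenvalue (`mem_closure_compl_of_singular`). -/

namespace MatrixPencil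

open Matrix Polynomial Filter Topology

variable {n : ℕ}

/-! ### The determinant polynomial of a pencil. -/

/-- The polynomial `det (X A - B)` of the pencil `(A, B)`. -/
noncomputable def pencilPoly (A B : Matrix (Fin n) (Fin n) ℝ) : ℝ[X] :=
  ((X : ℝ[X]) • A.map C - B.map C).det

theorem eval_pencilPoly (A B : Matrix (Fin n) (Fin n) ℝ) (s : ℝ) :
    (pencilPoly A B).eval s = (s • A - B).det := by
  rw [pencilPoly, ← coe_evalRingHom, RingHom.map_det]
  congr 1
  ext i j
  simp
  ring

theorem det_map_C (A : Matrix (Fin n) (Fin n) ℝ) : (A.map C).det = C A.det := by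
  rw [RingHom.map_det]; rfl

theorem pencilPoly_mul_mul (P Q A B : Matrix (Fin n) (Fin n) ℝ) :
    pencilPoly (P * A * Q) (P * B * Q) = C (P.det * Q.det) * pencilPoly A B := by
  have h : (X : ℝ[X]) • (P * A * Q).map C - (P * B * Q).map C =
      P.map C * ((X : ℝ[X]) • A.map C - B.map C) * Q.map C := by
    simp only [Matrix.map_mul, mul_sub, sub_mul, Matrix.mul_smul, Matrix.smul_mul]
  rw [pencilPoly, h, det_mul, det_mul, det_map_C, det_map_C, C_mul, pencilPoly]
  ring

theorem pencilPoly_eq_charpoly (A B : Matrix (Fin n) (Fin n) ℝ) (hA : A.det ≠ 0) :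
    pencilPoly A B = C A.det * (B * A⁻¹).charpoly := by
  have h : (X : ℝ[X]) • A.map C - B.map C = charmatrix (B * A⁻¹) * A.map C := by
    have hB : B * A⁻¹ * A = B := by
      rw [mul_assoc, nonsing_inv_mul _ (isUnit_iff_ne_zero.mpr hA), mul_one]
    rw [charmatrix, sub_mul]
    congr 1
    · rw [scalar_apply, smul_eq_diagonal_mul]
    · conv_lhs => rw [← hB]
      simp [Matrix.map_mul]
  rw [pencilPoly, h, det_mul, det_map_C, charpoly, mul_comm]

theorem det_of_column_zero {R : Type*} [CommRing R] (M : Matrix (Fin (n + 1)) (Fin (n + 1)) R)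
    (h : ∀ i : Fin n, M i.succ 0 = 0) : M.det = M 0 0 * (M.submatrix Fin.succ Fin.succ).det := by
  rw [det_succ_column_zero, Fin.sum_univ_succ]
  simp [h]

theorem pencilPoly_of_column_zero (A B : Matrix (Fin (n + 1)) (Fin (n + 1)) ℝ)
    (hA : ∀ i : Fin n, A i.succ 0 = 0) (hB : ∀ i : Fin n, B i.succ 0 = 0) :
    pencilPoly A B = (C (A 0 0) * X - C (B 0 0)) *
      pencilPoly (A.submatrix Fin.succ Fin.succ) (B.submatrix Fin.succ Fin.succ) := by
  rw [pencilPoly, det_of_column_zero _ (by simp [hA, hB])]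
  rw [mul_comm (C _) X]
  rfl

theorem pencilPoly_of_upperTriangular (A B : Matrix (Fin n) (Fin n) ℝ)
    (hA : A.BlockTriangular id) (hB : B.BlockTriangular id) :
    pencilPoly A B = ∏ i, (C (A i i) * X - C (B i i)) := by
  rw [pencilPoly, det_of_isUpperTriangular]
  · refine Finset.prod_congr rfl fun i _ => ?_
    rw [mul_comm (C _) X]
    rfl
  · intro i j hij
    simp [hA hij, hB hij]

/-! ### Simultaneous triangularization by deflation. -/

/-- The pencil `(A, B)` is equivalent to a pencil of upper triangular matrices. -/
def Triangularizable (A B : Matrix (Fin n) (Fin n) ℝ) : Prop :=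
  ∃ P Q : Matrix (Fin n) (Fin n) ℝ, IsUnit P ∧ IsUnit Q ∧
    (P * A * Q).BlockTriangular id ∧ (P * B * Q).BlockTriangular id

theorem Triangularizable.of_equiv {A B P Q : Matrix (Fin n) (Fin n) ℝ} (hP : IsUnit P)
    (hQ : IsUnit Q) (h : Triangularizable (P * A * Q) (P * B * Q)) : Triangularizable A B := by
  obtain ⟨P', Q', hP', hQ', hA, hB⟩ := h
  refine ⟨P' * P, Q * Q', hP'.mul hP, hQ.mul hQ', ?_, ?_⟩
  · convert hA using 1; simp only [mul_assoc]
  · convert hB using 1; simp only [mul_assoc]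

/-- Transposition gives lower triangular matrices; reversing the order of rows and columns makes
them upper triangular again. -/
theorem Triangularizable.of_transpose {A B : Matrix (Fin n) (Fin n) ℝ}
    (h : Triangularizable Aᵀ Bᵀ) : Triangularizable A B := by
  obtain ⟨P, Q, hP, hQ, hA, hB⟩ := h
  have key : ∀ M : Matrix (Fin n) (Fin n) ℝ,
      Qᵀ.submatrix Fin.revPerm id * M * Pᵀ.submatrix id Fin.revPerm =
        (P * Mᵀ * Q)ᵀ.submatrix Fin.rev Fin.rev := by
    intro M
    rw [transpose_mul, transpose_mul, transpose_transpose, ← mul_assoc]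
    rfl
  have tri : ∀ M : Matrix (Fin n) (Fin n) ℝ, M.BlockTriangular id →
      (Mᵀ.submatrix Fin.rev Fin.rev).BlockTriangular id := by
    intro M hM i j hij
    exact hM (Fin.rev_lt_rev.mpr hij)
  refine ⟨Qᵀ.submatrix Fin.revPerm id, Pᵀ.submatrix id Fin.revPerm, ?_, ?_, ?_, ?_⟩
  · exact (isUnit_submatrix_equiv (e₁ := Fin.revPerm) (e₂ := Equiv.refl _)).mpr
      ((isUnit_transpose _).mpr hQ)
  · exact (isUnit_submatrix_equiv (e₁ := Equiv.refl _) (e₂ := Fin.revPerm)).mpr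
      ((isUnit_transpose _).mpr hP)
  · rw [key]; exact tri _ hA
  · rw [key]; exact tri _ hB

/-- The block diagonal matrix with blocks `1` and `M`. -/
def border (M : Matrix (Fin n) (Fin n) ℝ) : Matrix (Fin (n + 1)) (Fin (n + 1)) ℝ :=
  of (Fin.cons (Fin.cons 1 0) fun i => Fin.cons 0 (M i))

@[simp] theorem border_zero_zero (M : Matrix (Fin n) (Fin n) ℝ) : border M 0 0 = 1 := rfl
@[simp] theorem border_zero_succ (M : Matrix (Fin n) (Fin n) ℝ) (j : Fin n) :
    border M 0 j.succ = 0 := rfl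
@[simp] theorem border_succ_zero (M : Matrix (Fin n) (Fin n) ℝ) (i : Fin n) :
    border M i.succ 0 = 0 := rfl
@[simp] theorem border_succ_succ (M : Matrix (Fin n) (Fin n) ℝ) (i j : Fin n) :
    border M i.succ j.succ = M i j := rfl

theorem isUnit_border {M : Matrix (Fin n) (Fin n) ℝ} (h : IsUnit M) : IsUnit (border M) := by
  rw [isUnit_iff_isUnit_det] at h ⊢
  rw [det_of_column_zero _ (by simp)]
  rw [border_zero_zero, one_mul]
  exact h

theorem blockTriangular_border_mul_mul (P Q A : Matrix (Fin n) (Fin n) ℝ)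
    (M : Matrix (Fin (n + 1)) (Fin (n + 1)) ℝ) (hA : M.submatrix Fin.succ Fin.succ = A)
    (hM : ∀ i : Fin n, M i.succ 0 = 0) (h : (P * A * Q).BlockTriangular id) :
    (border P * M * border Q).BlockTriangular id := by
  intro i j hij
  cases i using Fin.cases with
  | zero => exact absurd hij (Fin.not_lt_zero _)
  | succ i =>
    cases j using Fin.cases with
    | zero => simp [Matrix.mul_apply, Fin.sum_univ_succ, hM]
    | succ j =>
      have h' := @h i j (Fin.succ_lt_succ_iff.mp hij)
      subst hA
      simpa [Matrix.mul_apply, Fin.sum_univ_succ] using h'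

theorem Triangularizable.of_column_zero {A B : Matrix (Fin (n + 1)) (Fin (n + 1)) ℝ}
    (hA : ∀ i : Fin n, A i.succ 0 = 0) (hB : ∀ i : Fin n, B i.succ 0 = 0)
    (h : Triangularizable (A.submatrix Fin.succ Fin.succ) (B.submatrix Fin.succ Fin.succ)) :
    Triangularizable A B := by
  obtain ⟨P, Q, hP, hQ, h1, h2⟩ := h
  exact ⟨border P, border Q, isUnit_border hP, isUnit_border hQ,
    blockTriangular_border_mul_mul _ _ _ _ rfl hA h1,
    blockTriangular_border_mul_mul _ _ _ _ rfl hB h2⟩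

theorem exists_isUnit_mulVec_eq {x y : Fin n → ℝ} (hx : x ≠ 0) (hy : y ≠ 0) :
    ∃ P : Matrix (Fin n) (Fin n) ℝ, IsUnit P ∧ P *ᵥ x = y := by
  obtain ⟨e, he⟩ := SeparatingDual.exists_continuousLinearEquiv_apply_eq (R := ℝ) hx hy
  refine ⟨LinearMap.toMatrix' e.toLinearEquiv.toLinearMap, ?_, ?_⟩
  · rw [isUnit_iff_isUnit_det, LinearMap.det_toMatrix']
    exact LinearEquiv.isUnit_det' _
  · rw [LinearMap.toMatrix'_mulVec]
    exact he

/-- If `A x` and `B x` both lie on a line, the pencil is equivalent to one whose first columns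
are multiples of the first basis vector. -/
theorem exists_column_zero {A B : Matrix (Fin (n + 1)) (Fin (n + 1)) ℝ} {x w : Fin (n + 1) → ℝ}
    {a b : ℝ} (hx : x ≠ 0) (hw : w ≠ 0) (hA : A *ᵥ x = a • w) (hB : B *ᵥ x = b • w) :
    ∃ P Q : Matrix (Fin (n + 1)) (Fin (n + 1)) ℝ, IsUnit P ∧ IsUnit Q ∧
      P *ᵥ w = Pi.single 0 1 ∧ (P * A * Q).col 0 = Pi.single 0 a ∧
      (P * B * Q).col 0 = Pi.single 0 b := by
  have he : (Pi.single 0 1 : Fin (n + 1) → ℝ) ≠ 0 := by simp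
  obtain ⟨P, hP, hPw⟩ := exists_isUnit_mulVec_eq hw he
  obtain ⟨Q, hQ, hQx⟩ := exists_isUnit_mulVec_eq he hx
  have key : ∀ (M : Matrix (Fin (n + 1)) (Fin (n + 1)) ℝ) (c : ℝ), M *ᵥ x = c • w →
      (P * M * Q).col 0 = Pi.single 0 c := by
    intro M c h
    rw [← mulVec_single_one, ← mulVec_mulVec, hQx, ← mulVec_mulVec, h, mulVec_smul, hPw,
      ← Pi.single_smul, smul_eq_mul, mul_one]
  exact ⟨P, Q, hP, hQ, hPw, key A a hA, key B b hB⟩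

/-- `A` is singular, so some `x ≠ 0` has `A x = 0`, and `B x` lies on a line orthogonal to `y`.
Deflating along `x` moves that line to the first axis; the transported `y` then has first coordinate
zero, and its tail is a common left null vector of the smaller pencil. -/
theorem triangularizable_of_common_vecMul (A B : Matrix (Fin n) (Fin n) ℝ) (y : Fin n → ℝ)
    (hy : y ≠ 0) (hA : y ᵥ* A = 0) (hB : y ᵥ* B = 0) : Triangularizable A B := by
  induction n with
  | zero => exact absurd (Subsingleton.elim y 0) hy
  | succ n ih =>
    rcases Nat.eq_zero_or_pos n with rfl | hn
    · refine ⟨1, 1, isUnit_one, isUnit_one, ?_, ?_⟩ <;> intro i j hij <;>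
        exact absurd hij (by simp [Fin.fin_one_eq_zero])
    obtain ⟨x, hx, hAx⟩ := exists_mulVec_eq_zero_iff.mpr
      (exists_vecMul_eq_zero_iff.mp ⟨y, hy, hA⟩)
    obtain ⟨w, b, hw, hyw, hBx⟩ : ∃ (w : Fin (n + 1) → ℝ) (b : ℝ), w ≠ 0 ∧ y ⬝ᵥ w = 0 ∧
        B *ᵥ x = b • w := by
      by_cases hb : B *ᵥ x = 0
      -- Any nonzero `w` orthogonal to `y` serves; it exists because the matrix with all rows `y`
      -- has at least two rows, hence is singular.
      · obtain ⟨w, hw, h⟩ := exists_mulVec_eq_zero_iff.mpr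
          (show (of fun _ => y : Matrix (Fin (n + 1)) (Fin (n + 1)) ℝ).det = 0 from
            det_zero_of_row_eq (i := 0) (j := Fin.last n) (by
              simp [Fin.ext_iff]; lia) rfl)
        exact ⟨w, 0, hw, congrFun h 0, by simp [hb]⟩
      · exact ⟨B *ᵥ x, 1, hb, by rw [dotProduct_mulVec, hB, zero_dotProduct], by simp⟩
    obtain ⟨P, Q, hP, hQ, hPw, hA0, hB0⟩ := exists_column_zero (a := 0) hx hw (by simpa) hBx
    refine Triangularizable.of_equiv hP hQ ?_
    refine Triangularizable.of_column_zero (fun i => by simpa using congrFun hA0 i.succ)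
      (fun i => by simpa using congrFun hB0 i.succ) ?_
    have hPd : IsUnit P.det := (isUnit_iff_isUnit_det P).mp hP
    set y' := y ᵥ* P⁻¹ with hy'
    have hyP : y' ᵥ* P = y := by
      rw [hy', vecMul_vecMul, nonsing_inv_mul _ hPd, vecMul_one]
    have h0 : y' 0 = 0 := by
      have : y' ⬝ᵥ (P *ᵥ w) = 0 := by rw [dotProduct_mulVec, hyP, hyw]
      simpa [hPw] using this
    have key : ∀ M : Matrix (Fin (n + 1)) (Fin (n + 1)) ℝ, y ᵥ* M = 0 →
        (fun i : Fin n => y' i.succ) ᵥ* (P * M * Q).submatrix Fin.succ Fin.succ = 0 := by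
      intro M hM
      have h1 : y' ᵥ* (P * M * Q) = 0 := by
        rw [← vecMul_vecMul, ← vecMul_vecMul, hyP, hM, zero_vecMul]
      funext j
      have h2 := congrFun h1 j.succ
      simpa [vecMul, dotProduct, Fin.sum_univ_succ, h0] using h2
    refine ih _ _ _ (fun h => hy ?_) (key A hA) (key B hB)
    have : y' = 0 := by
      funext i
      cases i using Fin.cases with
      | zero => exact h0
      | succ i => exact congrFun h i
    rw [← hyP, this, zero_vecMul]

theorem triangularizable_of_common_mulVec (A B : Matrix (Fin n) (Fin n) ℝ) (x : Fin n → ℝ)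
    (hx : x ≠ 0) (hA : A *ᵥ x = 0) (hB : B *ᵥ x = 0) : Triangularizable A B :=
  .of_transpose (triangularizable_of_common_vecMul _ _ x hx
    (by rwa [vecMul_transpose]) (by rwa [vecMul_transpose]))

/-- A real pencil is triangularizable if it is singular, or if its first matrix is nonsingular
and all its eigenvalues are real. -/
theorem triangularizable_of_splits (A B : Matrix (Fin n) (Fin n) ℝ)
    (h : pencilPoly A B = 0 ∨ A.det ≠ 0 ∧ (pencilPoly A B).Splits) : Triangularizable A B := by
  induction n with
  | zero => exact ⟨1, 1, isUnit_one, isUnit_one, fun i => i.elim0, fun i => i.elim0⟩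
  | succ n ih =>
    -- In the singular case every `t` is a root, so `0` will do.
    obtain ⟨t, ht⟩ : ∃ t, (pencilPoly A B).eval t = 0 := by
      rcases h with h | ⟨hA, h⟩
      · exact ⟨0, by simp [h]⟩
      · refine h.exists_eval_eq_zero ?_
        rw [pencilPoly_eq_charpoly A B hA, degree_C_mul hA, charpoly_degree_eq_dim]
        simp
        norm_cast
    rw [eval_pencilPoly] at ht
    obtain ⟨x, hx, hxt⟩ := exists_mulVec_eq_zero_iff.mpr ht
    have hBx : B *ᵥ x = t • A *ᵥ x := by
      rw [sub_mulVec, sub_eq_zero, smul_mulVec] at hxt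
      exact hxt.symm
    by_cases hw : A *ᵥ x = 0
    · exact triangularizable_of_common_mulVec A B x hx hw (by rw [hBx, hw, smul_zero])
    obtain ⟨P, Q, hP, hQ, -, hA0, hB0⟩ := exists_column_zero (a := 1) hx hw (one_smul ℝ _).symm hBx
    have hA1 : ∀ i : Fin n, (P * A * Q) i.succ 0 = 0 := fun i => by simpa using congrFun hA0 i.succ
    have hB1 : ∀ i : Fin n, (P * B * Q) i.succ 0 = 0 := fun i => by simpa using congrFun hB0 i.succ
    have hA2 : (P * A * Q) 0 0 = 1 := by simpa using congrFun hA0 0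
    have hB2 : (P * B * Q) 0 0 = t := by simpa using congrFun hB0 0
    refine .of_equiv hP hQ (.of_column_zero hA1 hB1 (ih _ _ ?_))
    have hPQ : P.det * Q.det ≠ 0 := mul_ne_zero
      ((isUnit_iff_isUnit_det P).mp hP).ne_zero ((isUnit_iff_isUnit_det Q).mp hQ).ne_zero
    have hp := pencilPoly_mul_mul P Q A B
    -- Now `X - t` times the polynomial of the deflated pencil is a nonzero constant times the
    -- original, so either alternative of `h` passes to the deflated pencil.
    rw [pencilPoly_of_column_zero _ _ hA1 hB1, hA2, hB2, C_1, one_mul] at hp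
    rcases h with h | ⟨hA, h⟩
    · left
      rw [h, mul_zero] at hp
      exact (mul_eq_zero.mp hp).resolve_left (X_sub_C_ne_zero t)
    · right
      constructor
      · have hd : (P * A * Q).det ≠ 0 := by
          rw [det_mul, det_mul, mul_right_comm]
          exact mul_ne_zero hPQ hA
        rw [det_of_column_zero _ hA1, hA2, one_mul] at hd
        exact hd
      · rw [← splits_X_sub_C_mul_iff (a := t), hp]
        exact h.C_mul _

/-! ### Diagonalizable pencils and their invariance under equivalence. -/

/-- The pencils `(P diag(c) Q, P diag(d) Q)`. -/
def diagonalPencils (n : ℕ) : Set (Matrix (Fin n) (Fin n) ℝ × Matrix (Fin n) (Fin n) ℝ) :=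
  {p | ∃ (P Q : Matrix (Fin n) (Fin n) ℝ) (c d : Fin n → ℝ),
    p.1 = P * diagonal c * Q ∧ p.2 = P * diagonal d * Q}

theorem diagonalPencils_mul_mul {A B : Matrix (Fin n) (Fin n) ℝ} (P Q : Matrix (Fin n) (Fin n) ℝ)
    (h : (A, B) ∈ diagonalPencils n) : (P * A * Q, P * B * Q) ∈ diagonalPencils n := by
  obtain ⟨P', Q', c, d, rfl, rfl⟩ := h
  exact ⟨P * P', Q' * Q, c, d, by simp only [mul_assoc], by simp only [mul_assoc]⟩

theorem inv_mul_mul_mul_inv {P Q : Matrix (Fin n) (Fin n) ℝ} (hP : IsUnit P) (hQ : IsUnit Q)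
    (M : Matrix (Fin n) (Fin n) ℝ) : P⁻¹ * (P * M * Q) * Q⁻¹ = M := by
  rw [isUnit_iff_isUnit_det] at hP hQ
  rw [mul_assoc P, nonsing_inv_mul_cancel_left _ _ hP, mul_nonsing_inv_cancel_right _ _ hQ]

theorem mul_mul_mem_diagonalPencils_iff {A B P Q : Matrix (Fin n) (Fin n) ℝ} (hP : IsUnit P)
    (hQ : IsUnit Q) : (P * A * Q, P * B * Q) ∈ diagonalPencils n ↔ (A, B) ∈ diagonalPencils n := by
  refine ⟨fun h => ?_, diagonalPencils_mul_mul P Q⟩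
  have := diagonalPencils_mul_mul P⁻¹ Q⁻¹ h
  rwa [inv_mul_mul_mul_inv hP hQ, inv_mul_mul_mul_inv hP hQ] at this

theorem continuous_mul_mul (P Q : Matrix (Fin n) (Fin n) ℝ) :
    Continuous fun p : Matrix (Fin n) (Fin n) ℝ × Matrix (Fin n) (Fin n) ℝ =>
      (P * p.1 * Q, P * p.2 * Q) := by
  fun_prop

theorem mem_closure_of_mul_mul {A B P Q : Matrix (Fin n) (Fin n) ℝ} (hP : IsUnit P)
    (hQ : IsUnit Q) (h : (P * A * Q, P * B * Q) ∈ closure (diagonalPencils n)) :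
    (A, B) ∈ closure (diagonalPencils n) := by
  have := map_mem_closure (continuous_mul_mul P⁻¹ Q⁻¹) h
    (fun p hp => diagonalPencils_mul_mul P⁻¹ Q⁻¹ hp)
  simpa only [inv_mul_mul_mul_inv hP hQ] using this

theorem mem_closure_compl_of_mul_mul {A B P Q : Matrix (Fin n) (Fin n) ℝ} (hP : IsUnit P)
    (hQ : IsUnit Q) (h : (P * A * Q, P * B * Q) ∈ closure (diagonalPencils n)ᶜ) :
    (A, B) ∈ closure (diagonalPencils n)ᶜ := by
  have := map_mem_closure (t := (diagonalPencils n)ᶜ) (continuous_mul_mul P⁻¹ Q⁻¹) h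
    (fun p hp => mt (mul_mul_mem_diagonalPencils_iff (isUnit_nonsing_inv_iff.mpr hP)
      (isUnit_nonsing_inv_iff.mpr hQ)).mp hp)
  simpa only [inv_mul_mul_mul_inv hP hQ] using this

/-! ### Distinct real eigenvalues: interior points. -/

theorem exists_diagonal_of_distinct_roots {A B : Matrix (Fin n) (Fin n) ℝ} (hA : A.det ≠ 0)
    {μ : Fin n → ℝ} (hμ : Function.Injective μ) (h : ∀ l, (μ l • A - B).det = 0) :
    ∃ P Q : Matrix (Fin n) (Fin n) ℝ, A = P * Q ∧ B = P * diagonal μ * Q := by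
  have hA' : IsUnit A.det := isUnit_iff_ne_zero.mpr hA
  choose v hv hv0 using fun l => exists_mulVec_eq_zero_iff.mpr (h l)
  have hB : ∀ l, B *ᵥ v l = A *ᵥ (μ l • v l) := by
    intro l
    have := hv0 l
    rw [sub_mulVec, sub_eq_zero, smul_mulVec, ← mulVec_smul] at this
    exact this.symm
  have hli : LinearIndependent ℝ v := by
    refine Module.End.eigenvectors_linearIndependent' (toLin' (A⁻¹ * B)) μ hμ v fun l => ?_
    refine ⟨Module.End.mem_eigenspace_iff.mpr ?_, hv l⟩
    rw [toLin'_apply, ← mulVec_mulVec, hB, mulVec_mulVec, nonsing_inv_mul _ hA', one_mulVec]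
  -- The columns of `V` are the eigenvectors of `A⁻¹ B`; the factors are `P = A V` and `Q = V⁻¹`.
  set V : Matrix (Fin n) (Fin n) ℝ := (of v)ᵀ with hV
  have hVu : IsUnit V.det := by
    rw [← isUnit_iff_isUnit_det, hV, isUnit_transpose]
    exact linearIndependent_rows_iff_isUnit.mp hli
  refine ⟨A * V, V⁻¹, (mul_nonsing_inv_cancel_right _ _ hVu).symm, ?_⟩
  have hBV : B * V = A * V * diagonal μ := by
    ext i l
    have h1 := congrFun (hB l) i
    rw [mul_assoc]
    calc (B * V) i l = (B *ᵥ v l) i := rfl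
      _ = (A *ᵥ (μ l • v l)) i := h1
      _ = (A * (V * diagonal μ)) i l := by
        rw [Matrix.mul_apply, mulVec, dotProduct]
        refine Finset.sum_congr rfl fun k _ => ?_
        rw [mul_diagonal, Pi.smul_apply, smul_eq_mul, mul_comm (μ l)]
        rfl
  rw [← hBV, mul_nonsing_inv_cancel_right _ _ hVu]

theorem mem_diagonalPencils_of_distinct_roots {A B : Matrix (Fin n) (Fin n) ℝ} (hA : A.det ≠ 0)
    {μ : Fin n → ℝ} (hμ : Function.Injective μ) (h : ∀ l, (μ l • A - B).det = 0) :
    (A, B) ∈ diagonalPencils n := by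
  obtain ⟨P, Q, hP, hQ⟩ := exists_diagonal_of_distinct_roots hA hμ h
  exact ⟨P, Q, 1, μ, by simpa [Pi.one_def] using hP, hQ⟩

theorem mem_interior_of_distinct_roots {A B : Matrix (Fin n) (Fin n) ℝ} (hA : A.det ≠ 0)
    {μ : Fin n → ℝ} (hμ : Function.Injective μ) (h : ∀ l, (μ l • A - B).det = 0) :
    (A, B) ∈ interior (diagonalPencils n) := by
  have hdet : ∀ s, (s • A - B).det = A.det * ∏ k, (s - μ k) := by
    obtain ⟨P, Q, rfl, rfl⟩ := exists_diagonal_of_distinct_roots hA hμ h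
    intro s
    have : s • (P * Q) - P * diagonal μ * Q = P * diagonal (fun k => s - μ k) * Q := by
      have hd : diagonal (fun k => s - μ k) = s • (1 : Matrix (Fin n) (Fin n) ℝ) - diagonal μ := by
        rw [smul_one_eq_diagonal, diagonal_sub]
      rw [hd]
      simp [mul_sub, sub_mul]
    rw [this, det_mul, det_mul, det_mul, det_diagonal]
    ring
  -- The factor `2` makes the closed intervals of radius `ε` about the roots disjoint, so roots
  -- found in them are distinct.
  obtain ⟨ε, hε, hε'⟩ : ∃ ε : ℝ, 0 < ε ∧ ∀ l k, l ≠ k → 2 * ε < |μ l - μ k| := by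
    have : ∀ᶠ ε in 𝓝[>] (0 : ℝ), ∀ l k, l ≠ k → 2 * ε < |μ l - μ k| := by
      refine eventually_all.mpr fun l => eventually_all.mpr fun k => ?_
      by_cases hlk : l = k
      · exact Eventually.of_forall fun _ hn => absurd hlk hn
      · have hc : Continuous fun ε : ℝ => 2 * ε := by fun_prop
        have h0 : (2 : ℝ) * 0 < |μ l - μ k| := by
          rw [mul_zero]; exact abs_pos.mpr (sub_ne_zero.mpr (hμ.ne hlk))
        filter_upwards [((hc.tendsto 0).mono_left nhdsWithin_le_nhds).eventually_lt_const h0]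
          with ε he _ using he
    obtain ⟨ε, h1, h2⟩ := (this.and self_mem_nhdsWithin).exists
    exact ⟨ε, h2, h1⟩
  have hsign : ∀ l, ((μ l - ε) • A - B).det * ((μ l + ε) • A - B).det < 0 := by
    intro l
    have : ((μ l - ε) • A - B).det * ((μ l + ε) • A - B).det =
        A.det ^ 2 * ∏ k, ((μ l - μ k) ^ 2 - ε ^ 2) := by
      rw [hdet, hdet, mul_mul_mul_comm, ← Finset.prod_mul_distrib, sq]
      congr 1
      exact Finset.prod_congr rfl fun k _ => by ring
    rw [this, ← Finset.mul_prod_erase _ _ (Finset.mem_univ l)]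
    -- Only the factor `k = l`, equal to `-ε ^ 2`, is negative.
    refine mul_neg_of_pos_of_neg (by positivity) (mul_neg_of_neg_of_pos ?_ ?_)
    · rw [sub_self]; nlinarith
    · refine Finset.prod_pos fun k hk => ?_
      have := hε' l k (Finset.ne_of_mem_erase hk).symm
      rw [sub_pos, ← sq_abs (μ l - μ k)]
      gcongr
      linarith
  have hcont : ∀ s : ℝ, Continuous fun p : Matrix (Fin n) (Fin n) ℝ × Matrix (Fin n) (Fin n) ℝ =>
      (s • p.1 - p.2).det := fun s => by fun_prop
  rw [mem_interior_iff_mem_nhds]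
  have h1 : ∀ᶠ p in 𝓝 (A, B), ∀ l,
      ((μ l - ε) • p.1 - p.2).det * ((μ l + ε) • p.1 - p.2).det < 0 :=
    eventually_all.mpr fun l =>
      (((hcont (μ l - ε)).mul (hcont (μ l + ε))).tendsto (A, B)).eventually_lt_const (hsign l)
  have h2 : ∀ᶠ p : Matrix (Fin n) (Fin n) ℝ × Matrix (Fin n) (Fin n) ℝ in 𝓝 (A, B),
      p.1.det ≠ 0 := (continuous_fst.matrix_det.tendsto (A, B)).eventually_ne hA
  filter_upwards [h1, h2] with p hp hp'
  have hroot : ∀ l, ∃ s, |s - μ l| ≤ ε ∧ (s • p.1 - p.2).det = 0 := by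
    intro l
    have hc : ContinuousOn (fun s : ℝ => (s • p.1 - p.2).det)
        (Set.uIcc (μ l - ε) (μ l + ε)) := by fun_prop
    have h0 : (0 : ℝ) ∈ Set.uIcc ((μ l - ε) • p.1 - p.2).det ((μ l + ε) • p.1 - p.2).det := by
      rw [Set.mem_uIcc]
      rcases mul_neg_iff.mp (hp l) with h | h
      · exact Or.inr ⟨h.2.le, h.1.le⟩
      · exact Or.inl ⟨h.1.le, h.2.le⟩
    obtain ⟨s, hs, hs0⟩ := intermediate_value_uIcc hc h0
    rw [Set.uIcc_of_le (by linarith), Set.mem_Icc] at hs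
    exact ⟨s, abs_le.mpr ⟨by linarith, by linarith⟩, hs0⟩
  choose ν hν hν0 using hroot
  refine mem_diagonalPencils_of_distinct_roots hp' (μ := ν) (fun l k hlk => ?_) hν0
  by_contra hne
  have h3 := hε' l k hne
  have h4 := hν l
  have h5 := hν k
  rw [← hlk] at h5
  rw [abs_sub_comm] at h4
  have := abs_sub_le (μ l) (ν l) (μ k)
  linarith

/-! ### Triangularizable pencils are limits of diagonalizable ones. -/

theorem eventually_eval_ne_zero {p : ℝ[X]} (hp : p ≠ 0) : ∀ᶠ ε in 𝓝[≠] (0 : ℝ), p.eval ε ≠ 0 := by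
  have h := (p.finite_setOfPred_isRoot hp).compl_mem_cofinite
  exact nhdsNE_le_cofinite 0 h

theorem mem_closure_of_triangularizable {A B : Matrix (Fin n) (Fin n) ℝ}
    (h : Triangularizable A B) : (A, B) ∈ closure (diagonalPencils n) := by
  obtain ⟨P, Q, hP, hQ, hA, hB⟩ := h
  refine mem_closure_of_mul_mul hP hQ ?_
  generalize P * A * Q = A at hA
  generalize P * B * Q = B at hB
  have hlim : Tendsto (fun ε : ℝ => (A + diagonal fun _ => ε, B + diagonal fun l : Fin n => ε * l))
      (𝓝[≠] 0) (𝓝 (A, B)) := by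
    have hc : Continuous fun ε : ℝ =>
        (A + diagonal fun _ => ε, B + diagonal fun l : Fin n => ε * l) := by fun_prop
    refine tendsto_nhdsWithin_of_tendsto_nhds ?_
    convert hc.tendsto 0 using 2
    simp
  refine mem_closure_of_tendsto hlim ?_
  have h1 : ∀ᶠ ε in 𝓝[≠] (0 : ℝ), ∀ l, A l l + ε ≠ 0 := by
    refine eventually_all.mpr fun l => ?_
    have := eventually_eval_ne_zero (p := X + C (A l l)) (X_add_C_ne_zero _)
    filter_upwards [this] with ε hε
    simpa [add_comm] using hε
  have h2 : ∀ᶠ ε in 𝓝[≠] (0 : ℝ), ∀ l k, l ≠ k →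
      (B l l + ε * l) * (A k k + ε) - (B k k + ε * k) * (A l l + ε) ≠ 0 := by
    refine eventually_all.mpr fun l => eventually_all.mpr fun k => ?_
    by_cases hlk : l = k
    · exact Eventually.of_forall fun _ hn => absurd hlk hn
    -- The cross-difference of two perturbed eigenvalue ratios, as a polynomial in `ε`. The weights
    -- `l` on the diagonal of `B` make its leading coefficient `l - k` nonzero.
    have hp : C ((l : ℝ) - k) * X ^ 2 + C (B l l + l * A k k - B k k - k * A l l) * X +
        C (B l l * A k k - B k k * A l l) ≠ 0 := by
      intro h0
      have := congrArg (fun p => p.coeff 2) h0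
      simp [-map_sub, -map_add, -map_mul, sub_eq_zero, Fin.val_inj, hlk] at this
    filter_upwards [eventually_eval_ne_zero hp] with ε hε _ h0
    apply hε
    simp only [eval_add, eval_mul, eval_C, eval_pow, eval_X]
    linear_combination h0
  filter_upwards [h1, h2] with ε hε1 hε2
  have hA' : (A + diagonal fun _ => ε).BlockTriangular id :=
    hA.add (blockTriangular_diagonal _)
  have hB' : (B + diagonal fun l : Fin n => ε * l).BlockTriangular id :=
    hB.add (blockTriangular_diagonal _)
  refine mem_diagonalPencils_of_distinct_roots
    (μ := fun l => (B l l + ε * l) / (A l l + ε)) ?_ ?_ ?_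
  · rw [det_of_isUpperTriangular hA']
    exact Finset.prod_ne_zero_iff.mpr fun l _ => by simpa using hε1 l
  · intro l k hlk
    by_contra hne
    rw [div_eq_div_iff (hε1 l) (hε1 k)] at hlk
    exact hε2 l k hne (sub_eq_zero.mpr hlk)
  · intro l
    rw [← eval_pencilPoly, pencilPoly_of_upperTriangular _ _ hA' hB', eval_prod]
    refine Finset.prod_eq_zero (Finset.mem_univ l) ?_
    simp [mul_div_cancel₀ _ (hε1 l)]

/-! ### Non-real eigenvalues: exterior points. -/

theorem det_map_ofReal (M : Matrix (Fin n) (Fin n) ℝ) :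
    (M.map Complex.ofReal).det = (M.det : ℂ) :=
  (RingHom.map_det Complex.ofRealHom M).symm

theorem map_ofReal_mul (M N : Matrix (Fin n) (Fin n) ℝ) :
    (M * N).map Complex.ofReal = M.map Complex.ofReal * N.map Complex.ofReal :=
  Matrix.map_mul (f := Complex.ofRealHom)

/-- The determinant factors through the numbers `z c - d` with `c`, `d` real, and each has imaginary
part `Im z * c`. -/
theorem le_norm_det_of_mem_diagonalPencils {p : Matrix (Fin n) (Fin n) ℝ × Matrix (Fin n) (Fin n) ℝ}
    (hp : p ∈ diagonalPencils n) (z : ℂ) :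
    |z.im| ^ n * |p.1.det| ≤ ‖(z • p.1.map Complex.ofReal - p.2.map Complex.ofReal).det‖ := by
  obtain ⟨P, Q, c, d, h1, h2⟩ := hp
  have h : z • p.1.map Complex.ofReal - p.2.map Complex.ofReal =
      P.map Complex.ofReal * diagonal (fun l => z * c l - d l) * Q.map Complex.ofReal := by
    have hd : diagonal (fun l => z * c l - d l) =
        z • (diagonal c).map Complex.ofReal - (diagonal d).map Complex.ofReal := by
      rw [diagonal_map Complex.ofReal_zero, diagonal_map Complex.ofReal_zero, ← diagonal_smul,
        diagonal_sub]
      rfl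
    rw [hd, h1, h2]
    simp only [map_ofReal_mul, mul_sub, sub_mul, Matrix.mul_smul, Matrix.smul_mul]
  rw [h, det_mul, det_mul, det_diagonal, det_map_ofReal, det_map_ofReal, h1, det_mul, det_mul,
    det_diagonal, norm_mul, norm_mul, Complex.norm_real, Complex.norm_real, Real.norm_eq_abs,
    Real.norm_eq_abs, abs_mul, abs_mul, norm_prod, Finset.abs_prod]
  have key : |z.im| ^ n * ∏ l, |c l| ≤ ∏ l, ‖z * c l - d l‖ := by
    have : |z.im| ^ n = ∏ _l : Fin n, |z.im| := by simp
    rw [this, ← Finset.prod_mul_distrib]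
    refine Finset.prod_le_prod (fun _ _ => by positivity) fun l _ => ?_
    have h3 := Complex.abs_im_le_norm (z * c l - d l)
    simpa [abs_mul] using h3
  calc |z.im| ^ n * (|P.det| * (∏ l, |c l|) * |Q.det|)
      = |P.det| * (|z.im| ^ n * ∏ l, |c l|) * |Q.det| := by ring
    _ ≤ _ := by gcongr

theorem notMem_closure_of_nonreal_root {A B : Matrix (Fin n) (Fin n) ℝ} (hA : A.det ≠ 0) {z : ℂ}
    (hz : z.im ≠ 0) (h : (z • A.map Complex.ofReal - B.map Complex.ofReal).det = 0) :
    (A, B) ∉ closure (diagonalPencils n) := by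
  intro hmem
  have hclosed : IsClosed {p : Matrix (Fin n) (Fin n) ℝ × Matrix (Fin n) (Fin n) ℝ |
      |z.im| ^ n * |p.1.det| ≤ ‖(z • p.1.map Complex.ofReal - p.2.map Complex.ofReal).det‖} := by
    refine isClosed_le (by fun_prop) (Continuous.norm (Continuous.matrix_det ?_))
    exact ((continuous_fst.matrix_map Complex.continuous_ofReal).const_smul z).sub
      (continuous_snd.matrix_map Complex.continuous_ofReal)
  have h1 : |z.im| ^ n * |A.det| ≤ ‖(z • A.map Complex.ofReal - B.map Complex.ofReal).det‖ :=
    closure_minimal (fun p hp => le_norm_det_of_mem_diagonalPencils hp z) hclosed hmem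
  rw [h, norm_zero] at h1
  have : 0 < |z.im| ^ n * |A.det| := by positivity
  linarith

/-! ### Multiple eigenvalues and singular pencils: limits of non-diagonalizable pencils. -/

/-- At a multiple eigenvalue there are either two independent eigenvectors or a Jordan chain. -/
theorem exists_linearIndependent_pair_of_rootMultiplicity {V : Type*} [AddCommGroup V] [Module ℝ V]
    [FiniteDimensional ℝ V] (f : Module.End ℝ V) {μ : ℝ}
    (h : 2 ≤ f.charpoly.rootMultiplicity μ) :
    ∃ (v w : V) (t : ℝ), 0 ≤ t ∧ LinearIndependent ℝ ![v, w] ∧ f v = μ • v ∧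
      f w = μ • w + t • v := by
  set N : Module.End ℝ V := f - μ • 1 with hN
  have hNf : ∀ u, f u = μ • u + N u := fun u => by simp [hN]
  by_cases hc : ∃ u, N (N u) = 0 ∧ N u ≠ 0
  · obtain ⟨u, h2, h1⟩ := hc
    refine ⟨N u, u, 1, zero_le_one, LinearIndependent.pair_iff.mpr fun a b hab => ?_, ?_, ?_⟩
    · have hb : b = 0 := by
        have := congrArg N hab
        rw [map_add, map_smul, map_smul, h2, smul_zero, zero_add, map_zero] at this
        exact (smul_eq_zero.mp this).resolve_right h1
      subst hb
      rw [zero_smul, add_zero] at hab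
      exact ⟨(smul_eq_zero.mp hab).resolve_right h1, rfl⟩
    · rw [hNf, h2, add_zero]
    · rw [hNf, one_smul]
  -- Without a Jordan chain the generalized eigenspace is the eigenspace, so its dimension is the
  -- algebraic multiplicity.
  · push Not at hc
    have hpow : ∀ (k : ℕ) (u : V), (N ^ k) u = 0 → N u = 0 := by
      intro k
      induction k with
      | zero => intro u hu; rw [show u = 0 from hu, map_zero]
      | succ k ih =>
        intro u hu
        exact hc u (ih _ (by rwa [pow_succ] at hu))
    have hle : f.maxGenEigenspace μ ≤ f.eigenspace μ := by
      intro u hu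
      obtain ⟨k, hk⟩ := (Module.End.mem_maxGenEigenspace f μ u).mp hu
      rw [Module.End.mem_eigenspace_iff, hNf, hpow k u hk, add_zero]
    rw [← LinearMap.finrank_maxGenEigenspace_eq] at h
    have h2 : 1 < Module.finrank ℝ (f.eigenspace μ) :=
      lt_of_lt_of_le h (Submodule.finrank_mono hle)
    obtain ⟨v, hv⟩ := (Module.finrank_pos_iff_exists_ne_zero (R := ℝ)).mp (zero_lt_one.trans h2)
    obtain ⟨w, hw⟩ := exists_linearIndependent_pair_of_one_lt_finrank h2 hv
    refine ⟨v, w, 0, le_rfl, ?_, Module.End.mem_eigenspace_iff.mp v.2, ?_⟩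
    · have := hw.map' (f.eigenspace μ).subtype (Submodule.ker_subtype _)
      have he : (f.eigenspace μ).subtype ∘ ![v, w] = ![(v : V), (w : V)] := by
        ext i
        fin_cases i <;> rfl
      rwa [he] at this
    · rw [Module.End.mem_eigenspace_iff.mp w.2, zero_smul, add_zero]

/-- A matrix with a multiple real eigenvalue can be moved in some direction so that non-real
eigenvalues appear. -/
theorem exists_perturbation_nonreal {M : Matrix (Fin n) (Fin n) ℝ} {μ : ℝ}
    (h : 2 ≤ M.charpoly.rootMultiplicity μ) :
    ∃ N : Matrix (Fin n) (Fin n) ℝ, ∀ ε : ℝ, 0 < ε → ∃ z : ℂ, z.im ≠ 0 ∧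
      (z • (1 : Matrix (Fin n) (Fin n) ℂ) - (M + ε • N).map Complex.ofReal).det = 0 := by
  rw [← charpoly_toLin'] at h
  obtain ⟨v, w, t, ht, hvw, hv, hw⟩ := exists_linearIndependent_pair_of_rootMultiplicity _ h
  rw [toLin'_apply] at hv hw
  -- `g` reads off the coordinates with respect to `v`, `w`, extended linearly to the whole space.
  obtain ⟨g, hg⟩ := LinearMap.exists_leftInverse_of_injective
    (Fintype.linearCombination ℝ ![v, w]) (LinearMap.ker_eq_bot.mpr hvw.fintypeLinearCombination_injective)
  have hgv : g v = Pi.single 0 1 := by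
    have := LinearMap.congr_fun hg (Pi.single 0 1)
    simpa [Fintype.linearCombination_apply_single] using this
  have hgw : g w = Pi.single 1 1 := by
    have := LinearMap.congr_fun hg (Pi.single 1 1)
    simpa [Fintype.linearCombination_apply_single] using this
  -- `N` is a quarter turn of the plane of `v`, `w`. There `M + ε N` acts by `!![μ, t + ε; -ε, μ]`,
  -- with eigenvalues `μ ± i √(ε (t + ε))`, non-real since `t ≥ 0`; `v + i c w` below is an
  -- eigenvector.
  let N : (Fin n → ℝ) →ₗ[ℝ] (Fin n → ℝ) :=
    ((LinearMap.proj 1).comp g).smulRight v - ((LinearMap.proj 0).comp g).smulRight w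
  have hNv : N v = -w := by simp [N, hgv]
  have hNw : N w = v := by simp [N, hgw]
  refine ⟨LinearMap.toMatrix' N, fun ε hε => ?_⟩
  set M' := M + ε • LinearMap.toMatrix' N with hM'
  have hM'v : M' *ᵥ v = μ • v - ε • w := by
    rw [hM', add_mulVec, smul_mulVec, LinearMap.toMatrix'_mulVec, hv, hNv, smul_neg, sub_eq_add_neg]
  have hM'w : M' *ᵥ w = μ • w + (t + ε) • v := by
    rw [hM', add_mulVec, smul_mulVec, LinearMap.toMatrix'_mulVec, hw, hNw, add_assoc, add_smul]
  have hs : 0 < t + ε := by linarith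
  set r := Real.sqrt (ε * (t + ε)) with hr
  have hr0 : 0 < r := Real.sqrt_pos.mpr (by positivity)
  have hr2 : r ^ 2 = ε * (t + ε) := Real.sq_sqrt (by positivity)
  refine ⟨μ + r * Complex.I, by simpa using hr0.ne', ?_⟩
  set c : ℝ := r / (t + ε) with hc
  have hc1 : c * (t + ε) = r := by rw [hc]; field_simp
  have hc2 : r * c = ε := by rw [hc, ← mul_div_assoc, ← sq, hr2]; field_simp
  have hmap : ∀ u : Fin n → ℝ, M'.map Complex.ofReal *ᵥ (fun i => (u i : ℂ)) =
      fun i => ((M' *ᵥ u) i : ℂ) := by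
    intro u
    funext i
    simp [mulVec, dotProduct]
  refine exists_mulVec_eq_zero_iff.mp
    ⟨(fun i => (v i : ℂ)) + (c * Complex.I) • (fun i => (w i : ℂ)), ?_, ?_⟩
  · intro h0
    refine hvw.ne_zero 0 (funext fun i => ?_)
    have := congrArg Complex.re (congrFun h0 i)
    simpa using this
  · rw [sub_mulVec, smul_mulVec, one_mulVec, mulVec_add, mulVec_smul, hmap, hmap, hM'v, hM'w]
    funext i
    have e1 : (c : ℂ) * (t + ε) = r := by exact_mod_cast hc1
    have e2 : (r : ℂ) * c = ε := by exact_mod_cast hc2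
    simp only [Pi.sub_apply, Pi.add_apply, Pi.smul_apply, smul_eq_mul, Complex.ofReal_add,
      Complex.ofReal_mul, Complex.ofReal_sub, Pi.zero_apply]
    linear_combination (-Complex.I * v i) * e1 - w i * e2 + (r * c * w i : ℂ) * Complex.I_sq

theorem mem_closure_compl_of_rootMultiplicity {A B : Matrix (Fin n) (Fin n) ℝ} (hA : A.det ≠ 0)
    {μ : ℝ} (h : 2 ≤ (B * A⁻¹).charpoly.rootMultiplicity μ) :
    (A, B) ∈ closure (diagonalPencils n)ᶜ := by
  obtain ⟨N, hN⟩ := exists_perturbation_nonreal h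
  have hBA : B * A⁻¹ * A = B := by
    rw [mul_assoc, nonsing_inv_mul _ (isUnit_iff_ne_zero.mpr hA), mul_one]
  have hlim : Tendsto (fun ε : ℝ => (A, (B * A⁻¹ + ε • N) * A)) (𝓝[>] 0) (𝓝 (A, B)) := by
    have hc : Continuous fun ε : ℝ => (A, (B * A⁻¹ + ε • N) * A) := by fun_prop
    refine tendsto_nhdsWithin_of_tendsto_nhds ?_
    convert hc.tendsto 0 using 2
    rw [zero_smul, add_zero, hBA]
  refine mem_closure_of_tendsto hlim ?_
  filter_upwards [self_mem_nhdsWithin] with ε hε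
  obtain ⟨z, hz, hdet⟩ := hN ε hε
  intro hmem
  refine notMem_closure_of_nonreal_root hA hz ?_ (subset_closure hmem)
  have : z • A.map Complex.ofReal - ((B * A⁻¹ + ε • N) * A).map Complex.ofReal =
      (z • 1 - (B * A⁻¹ + ε • N).map Complex.ofReal) * A.map Complex.ofReal := by
    rw [map_ofReal_mul, sub_mul, smul_mul, one_mul]
  rw [this, det_mul, hdet, zero_mul]

theorem mem_closure_compl_of_singular {A B : Matrix (Fin n) (Fin n) ℝ} (hn : 2 ≤ n)
    (h : pencilPoly A B = 0) : (A, B) ∈ closure (diagonalPencils n)ᶜ := by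
  obtain ⟨P, Q, hP, hQ, hA, hB⟩ := triangularizable_of_splits A B (Or.inl h)
  refine mem_closure_compl_of_mul_mul hP hQ ?_
  have hpoly : pencilPoly (P * A * Q) (P * B * Q) = 0 := by
    rw [pencilPoly_mul_mul, h, mul_zero]
  generalize P * A * Q = A at hA hpoly
  generalize P * B * Q = B at hB hpoly
  obtain ⟨j, hj⟩ : ∃ j, A j j = 0 ∧ B j j = 0 := by
    rw [pencilPoly_of_upperTriangular _ _ hA hB, Finset.prod_eq_zero_iff] at hpoly
    obtain ⟨j, -, hj⟩ := hpoly
    refine ⟨j, ?_, ?_⟩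
    · simpa using congrArg (fun p => p.coeff 1) hj
    · simpa using congrArg (fun p => p.coeff 0) hj
  obtain ⟨i, hij⟩ : ∃ i, i ≠ j := by
    have : Nontrivial (Fin n) := Fin.nontrivial_iff_two_le.mpr hn
    exact exists_ne j
  -- The vanishing pair of diagonal entries at `j` becomes `ε` times the perturbed pair at `i`, so
  -- the two positions share the eigenvalue `B i i / (A i i + ε)`. The shift by `ε` elsewhere makes
  -- the first matrix nonsingular.
  let a : ℝ → Fin n → ℝ := fun ε l => if l = j then ε * (A i i + ε) else ε
  let b : ℝ → Fin n → ℝ := fun ε l => if l = j then ε * B i i else 0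
  have ha : Continuous a := by
    refine continuous_pi fun l => ?_
    by_cases hl : l = j <;> simp only [a, hl, if_true, if_false] <;> fun_prop
  have hb : Continuous b := by
    refine continuous_pi fun l => ?_
    by_cases hl : l = j <;> simp only [b, hl, if_true, if_false] <;> fun_prop
  have hlim : Tendsto (fun ε : ℝ => (A + diagonal (a ε), B + diagonal (b ε)))
      (𝓝[≠] 0) (𝓝 (A, B)) := by
    have hc : Continuous fun ε : ℝ => (A + diagonal (a ε), B + diagonal (b ε)) := by fun_prop
    refine tendsto_nhdsWithin_of_tendsto_nhds ?_
    convert hc.tendsto 0 using 2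
    simp [a, b]
  -- The perturbed pencils, having a double eigenvalue, are themselves only known to lie in the
  -- closure of the complement.
  rw [← closure_closure]
  refine mem_closure_of_tendsto hlim ?_
  have h1 : ∀ᶠ ε in 𝓝[≠] (0 : ℝ), ∀ l, A l l + ε ≠ 0 := by
    refine eventually_all.mpr fun l => ?_
    have := eventually_eval_ne_zero (p := X + C (A l l)) (X_add_C_ne_zero _)
    filter_upwards [this] with ε hε
    simpa [add_comm] using hε
  filter_upwards [h1, self_mem_nhdsWithin] with ε hε hε0
  have hε0' : ε ≠ 0 := hε0
  have hA' : (A + diagonal (a ε)).BlockTriangular id := hA.add (blockTriangular_diagonal _)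
  have hB' : (B + diagonal (b ε)).BlockTriangular id := hB.add (blockTriangular_diagonal _)
  have hdet : (A + diagonal (a ε)).det ≠ 0 := by
    rw [det_of_isUpperTriangular hA']
    refine Finset.prod_ne_zero_iff.mpr fun l _ => ?_
    by_cases hl : l = j
    · subst hl
      simpa [a, hj.1] using ⟨hε0', hε i⟩
    · simpa [a, hl] using hε l
  refine mem_closure_compl_of_rootMultiplicity hdet (μ := B i i / (A i i + ε)) ?_
  rw [le_rootMultiplicity_iff (charpoly_monic _).ne_zero,
    ← (isUnit_C.mpr (isUnit_iff_ne_zero.mpr hdet)).dvd_mul_left, ← pencilPoly_eq_charpoly _ _ hdet,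
    pencilPoly_of_upperTriangular _ _ hA' hB']
  refine dvd_trans ?_ (Finset.prod_dvd_prod_of_subset {i, j} Finset.univ _ (Finset.subset_univ _))
  rw [Finset.prod_pair hij, sq]
  have hfac : ∀ x y : ℝ, y = x * (B i i / (A i i + ε)) →
      X - C (B i i / (A i i + ε)) ∣ C x * X - C y := by
    intro x y hxy
    exact ⟨C x, by rw [hxy, C_mul]; ring⟩
  refine mul_dvd_mul (hfac _ _ ?_) (hfac _ _ ?_)
  · simp [a, b, hij, mul_div_cancel₀ _ (hε i)]
  · simp only [a, b, hj.1, hj.2, Matrix.add_apply, Matrix.diagonal_apply_eq, if_true, zero_add]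
    rw [mul_assoc, mul_div_cancel₀ _ (hε i)]

end MatrixPencil

/-! ### From arrays to pencils. -/

namespace RealArray

open Matrix Polynomial Topology MatrixPencil

theorem IsSumOfOuter.add_right {I J K R : ℕ} {Y : RealArray I J K} (h : IsSumOfOuter Y R) (k : ℕ) :
    IsSumOfOuter Y (R + k) := by
  obtain ⟨x, y, z, rfl⟩ := h
  refine ⟨Fin.append x 0, Fin.append y 0, Fin.append z 0, ?_⟩
  rw [Fin.sum_univ_add]
  simp only [Fin.append_left, Fin.append_right]
  rw [Finset.sum_eq_zero (s := (Finset.univ : Finset (Fin k))), add_zero]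
  intro l _
  funext a b c
  simp [outer]

theorem outerRank_le_iff {I J K R : ℕ} (Y : RealArray I J K) :
    outerRank Y ≤ R ↔ IsSumOfOuter Y R := by
  refine ⟨fun h => ?_, fun h => Nat.sInf_le h⟩
  have hm : IsSumOfOuter Y (outerRank Y) := Nat.sInf_mem (exists_isSumOfOuter Y)
  obtain ⟨k, rfl⟩ := Nat.exists_eq_add_of_le h
  exact hm.add_right k

theorem mul_diagonal_mul_apply {n : ℕ} (P Q : Matrix (Fin n) (Fin n) ℝ) (c : Fin n → ℝ)
    (i j : Fin n) : (P * diagonal c * Q) i j = ∑ l, P i l * c l * Q l j := by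
  rw [Matrix.mul_apply]
  exact Finset.sum_congr rfl fun l _ => by rw [mul_diagonal]

/-- The `x r` are the columns of `P`, the `y r` the rows of `Q`, and the two coordinates of the `z
r` the two diagonals. -/
theorem mem_rankSet_iff {n : ℕ} (Y : RealArray n n 2) :
    Y ∈ rankSet n n n 2 ↔ (slice Y 0, slice Y 1) ∈ diagonalPencils n := by
  rw [rankSet, Set.mem_ofPred_eq, outerRank_le_iff]
  constructor
  · rintro ⟨x, y, z, rfl⟩
    refine ⟨(of x)ᵀ, of y, fun l => z l 0, fun l => z l 1, ?_, ?_⟩ <;>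
    · ext i j
      rw [mul_diagonal_mul_apply]
      simp only [slice, of_apply, Finset.sum_apply, outer, transpose_apply]
      exact Finset.sum_congr rfl fun l _ => by ring
  · rintro ⟨P, Q, c, d, h0, h1⟩
    refine ⟨fun l i => P i l, fun l j => Q l j, fun l => ![c l, d l], ?_⟩
    funext i j k
    simp only [Finset.sum_apply, outer]
    have e0 := congrFun (congrFun h0 i) j
    have e1 := congrFun (congrFun h1 i) j
    rw [mul_diagonal_mul_apply] at e0 e1
    fin_cases k
    · refine Eq.trans e0 (Finset.sum_congr rfl fun l _ => ?_)
      simp only [Fin.zero_eta, cons_val_zero]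
      ring
    · refine Eq.trans e1 (Finset.sum_congr rfl fun l _ => ?_)
      simp only [Fin.mk_one, cons_val_one, cons_val_fin_one]
      ring

theorem slice_mix {n : ℕ} (U : Matrix (Fin 2) (Fin 2) ℝ) (Y : RealArray n n 2) (k : Fin 2) :
    slice (mix U Y) k = U k 0 • slice Y 0 + U k 1 • slice Y 1 := by
  ext i j
  simp [slice, mix, mulMat, Matrix.one_apply, Fin.sum_univ_two]

theorem diagonalPencils_mix {n : ℕ} (U : Matrix (Fin 2) (Fin 2) ℝ)
    {p : Matrix (Fin n) (Fin n) ℝ × Matrix (Fin n) (Fin n) ℝ} (hp : p ∈ diagonalPencils n) :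
    (U 0 0 • p.1 + U 0 1 • p.2, U 1 0 • p.1 + U 1 1 • p.2) ∈ diagonalPencils n := by
  obtain ⟨P, Q, c, d, h1, h2⟩ := hp
  have key : ∀ s t : ℝ, s • p.1 + t • p.2 = P * diagonal (s • c + t • d) * Q := by
    intro s t
    have hd : diagonal (s • c + t • d) = s • diagonal c + t • diagonal d := by
      rw [← diagonal_smul, ← diagonal_smul, diagonal_add]
      rfl
    rw [hd, h1, h2]
    simp only [mul_add, add_mul, Matrix.mul_smul, Matrix.smul_mul]
  exact ⟨P, Q, _, _, key _ _, key _ _⟩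

theorem inv_mul_entries {U : Matrix (Fin 2) (Fin 2) ℝ} (hU : U.det ≠ 0) (k l : Fin 2) :
    U⁻¹ k 0 * U 0 l + U⁻¹ k 1 * U 1 l = if k = l then 1 else 0 := by
  have := congrFun (congrFun (nonsing_inv_mul U (isUnit_iff_ne_zero.mpr hU)) k) l
  rwa [Matrix.mul_apply, Fin.sum_univ_two, one_apply] at this

theorem mul_inv_entries {U : Matrix (Fin 2) (Fin 2) ℝ} (hU : U.det ≠ 0) (k l : Fin 2) :
    U k 0 * U⁻¹ 0 l + U k 1 * U⁻¹ 1 l = if k = l then 1 else 0 := by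
  have := congrFun (congrFun (mul_nonsing_inv U (isUnit_iff_ne_zero.mpr hU)) k) l
  rwa [Matrix.mul_apply, Fin.sum_univ_two, one_apply] at this

/-- Mixing the two slices of an array by a nonsingular matrix. -/
noncomputable def mixHomeomorph (n : ℕ) {U : Matrix (Fin 2) (Fin 2) ℝ} (hU : U.det ≠ 0) :
    RealArray n n 2 ≃ₜ Matrix (Fin n) (Fin n) ℝ × Matrix (Fin n) (Fin n) ℝ where
  toFun Y := (slice (mix U Y) 0, slice (mix U Y) 1)
  invFun p i j k := U⁻¹ k 0 * p.1 i j + U⁻¹ k 1 * p.2 i j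
  left_inv Y := by
    funext i j k
    simp only [slice_mix, Matrix.add_apply, Matrix.smul_apply, smul_eq_mul]
    have h0 := inv_mul_entries hU k 0
    have h1 := inv_mul_entries hU k 1
    have e : ∀ l, slice Y l i j = Y i j l := fun l => rfl
    rw [e, e]
    fin_cases k <;> simp at h0 h1 ⊢ <;> linear_combination Y i j 0 * h0 + Y i j 1 * h1
  right_inv p := by
    have h : ∀ k, slice (mix U fun i j k => U⁻¹ k 0 * p.1 i j + U⁻¹ k 1 * p.2 i j) k =
        (if k = 0 then (1 : ℝ) else 0) • p.1 + (if k = 1 then (1 : ℝ) else 0) • p.2 := by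
      intro k
      rw [slice_mix, ← mul_inv_entries hU k 0, ← mul_inv_entries hU k 1]
      ext i j
      simp only [slice, Matrix.add_apply, Matrix.smul_apply, smul_eq_mul, of_apply]
      ring
    ext1
    · simpa using h 0
    · simpa using h 1
  continuous_toFun := by
    simp only [slice_mix]
    have hs : ∀ k : Fin 2, Continuous fun Y : RealArray n n 2 => slice Y k := fun k => by
      unfold slice
      fun_prop
    have h0 := hs 0
    have h1 := hs 1
    fun_prop
  continuous_invFun := by fun_prop

theorem mixHomeomorph_preimage (n : ℕ) {U : Matrix (Fin 2) (Fin 2) ℝ} (hU : U.det ≠ 0) :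
    mixHomeomorph n hU ⁻¹' diagonalPencils n = rankSet n n n 2 := by
  ext Y
  rw [mem_rankSet_iff, Set.mem_preimage]
  constructor
  · intro h
    have h' := (mixHomeomorph n hU).symm_apply_apply Y
    have := diagonalPencils_mix U⁻¹ h
    convert this using 1
    ext i j
    · exact (congrFun (congrFun (congrFun h' i) j) 0).symm
    · exact (congrFun (congrFun (congrFun h' i) j) 1).symm
  · intro h
    have := diagonalPencils_mix U h
    rwa [← slice_mix, ← slice_mix] at this

/-- Carries reality and multiplicities of the complex eigenvalues down to the real characteristic
polynomial. -/
theorem eigs_eq_map_roots {n : ℕ} {M : Matrix (Fin n) (Fin n) ℝ} (h : ∀ z ∈ eigs M, z.im = 0) :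
    M.charpoly.Splits ∧ eigs M = M.charpoly.roots.map (algebraMap ℝ ℂ) := by
  have he : eigs M = (M.charpoly.map (algebraMap ℝ ℂ)).roots := by
    rw [eigs]
    congr 1
    exact charpoly_map M (algebraMap ℝ ℂ)
  have hs : M.charpoly.Splits := by
    refine Splits.of_splits_map (algebraMap ℝ ℂ) (IsAlgClosed.splits _) fun z hz => ?_
    exact ⟨z.re, Complex.ext rfl (by simpa using (h z (he ▸ hz)).symm)⟩
  exact ⟨hs, by rw [he, hs.roots_map]⟩

theorem exists_injective_roots {n : ℕ} {M : Matrix (Fin n) (Fin n) ℝ} (hs : M.charpoly.Splits)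
    (hd : M.charpoly.roots.Nodup) :
    ∃ μ : Fin n → ℝ, Function.Injective μ ∧ ∀ l, M.charpoly.eval (μ l) = 0 := by
  have hcard : M.charpoly.roots.toFinset.card = n := by
    rw [Multiset.toFinset_card_of_nodup hd, ← hs.natDegree_eq_card_roots, charpoly_natDegree_eq_dim,
      Fintype.card_fin]
  let e := Finset.equivFinOfCardEq hcard
  refine ⟨fun l => e.symm l, Subtype.val_injective.comp e.symm.injective, fun l => ?_⟩
  exact (mem_roots'.mp (Multiset.mem_toFinset.mp (e.symm l).2)).2

/-- Mixing by this matrix gives the first slice `s Y₁ - Y₂`; under the hypothesis of (b) its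
determinant vanishes for all `s`. -/
theorem det_fin_two_of_neg_one_one_ne_zero (s : ℝ) :
    (!![s, -1; 1, 0] : Matrix (Fin 2) (Fin 2) ℝ).det ≠ 0 := by
  simp [det_fin_two]

end RealArray

open Matrix Polynomial MatrixPencil in
theorem proposition1 (I : ℕ) (Y : RealArray I I 2) :
    (∀ (U : Matrix (Fin 2) (Fin 2) ℝ) (X : RealArray I I 2) (M : Matrix (Fin I) (Fin I) ℝ),
      U.det ≠ 0 → X = RealArray.mix U Y → (RealArray.slice X 0).det ≠ 0 →
      M = RealArray.slice X 1 * (RealArray.slice X 0)⁻¹ →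
        (((∀ z ∈ RealArray.eigs M, z.im = 0) ∧ (RealArray.eigs M).Nodup →
            RealArray.IsInteriorPoint (RealArray.rankSet I I I 2) Y) ∧
         ((∀ z ∈ RealArray.eigs M, z.im = 0) ∧ ¬ (RealArray.eigs M).Nodup →
            RealArray.IsBoundaryPoint (RealArray.rankSet I I I 2) Y) ∧
         ((∃ z ∈ RealArray.eigs M, z.im ≠ 0) →
            RealArray.IsExteriorPoint (RealArray.rankSet I I I 2) Y))) ∧
    (2 ≤ I →
      (¬ ∃ U : Matrix (Fin 2) (Fin 2) ℝ,
        U.det ≠ 0 ∧ (RealArray.slice (RealArray.mix U Y) 0).det ≠ 0) →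
      RealArray.IsBoundaryPoint (RealArray.rankSet I I I 2) Y) := by
  constructor
  · rintro U X M hU rfl hX rfl
    have himage : RealArray.mixHomeomorph I hU Y =
      (RealArray.slice (RealArray.mix U Y) 0, RealArray.slice (RealArray.mix U Y) 1) := rfl
    rw [RealArray.IsInteriorPoint, RealArray.IsBoundaryPoint, RealArray.IsExteriorPoint,
      ← RealArray.mixHomeomorph_preimage I hU, ← Set.preimage_compl,
      ← Homeomorph.preimage_interior, ← Homeomorph.preimage_interior,
      ← Homeomorph.preimage_frontier, Set.mem_preimage, Set.mem_preimage, Set.mem_preimage, himage]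
    generalize RealArray.slice (RealArray.mix U Y) 0 = A at hX
    generalize RealArray.slice (RealArray.mix U Y) 1 = B
    refine ⟨?_, ?_, ?_⟩
    · rintro ⟨hreal, hnodup⟩
      obtain ⟨hs, he⟩ := RealArray.eigs_eq_map_roots hreal
      obtain ⟨μ, hμ, hroot⟩ := RealArray.exists_injective_roots hs
        (Multiset.Nodup.of_map _ (he ▸ hnodup))
      refine mem_interior_of_distinct_roots hX hμ fun l => ?_
      rw [← eval_pencilPoly, pencilPoly_eq_charpoly _ _ hX, eval_mul, hroot, mul_zero]
    · rintro ⟨hreal, hnodup⟩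
      obtain ⟨hs, he⟩ := RealArray.eigs_eq_map_roots hreal
      rw [frontier_eq_closure_inter_closure]
      refine ⟨mem_closure_of_triangularizable (triangularizable_of_splits _ _ (Or.inr ⟨hX, ?_⟩)), ?_⟩
      · rw [pencilPoly_eq_charpoly _ _ hX]
        exact hs.C_mul _
      · have hd : ¬ (B * A⁻¹).charpoly.roots.Nodup := fun h =>
          hnodup (he ▸ h.map (algebraMap ℝ ℂ).injective)
        rw [Multiset.nodup_iff_count_le_one] at hd
        push Not at hd
        obtain ⟨μ, hμ⟩ := hd
        rw [count_roots] at hμ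
        exact mem_closure_compl_of_rootMultiplicity hX hμ
    · rintro ⟨z, hz, him⟩
      rw [interior_compl]
      refine notMem_closure_of_nonreal_root hX him ?_
      have h0 := (mem_roots'.mp hz).2
      rw [IsRoot, eval_charpoly] at h0
      have hBA : B = B * A⁻¹ * A := by
        rw [mul_assoc, nonsing_inv_mul _ (isUnit_iff_ne_zero.mpr hX), mul_one]
      have : z • A.map Complex.ofReal - B.map Complex.ofReal =
          (scalar (Fin I) z - (B * A⁻¹).map (algebraMap ℝ ℂ)) * A.map Complex.ofReal := by
        conv_lhs => rw [hBA]
        rw [map_ofReal_mul, sub_mul, scalar_apply, smul_eq_diagonal_mul]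
        rfl
      rw [this, det_mul, h0, zero_mul]
  · intro hI hno
    push Not at hno
    -- No useful mix exists here; the identity mix only transports the question to pencils.
    have hU : (1 : Matrix (Fin 2) (Fin 2) ℝ).det ≠ 0 := by simp
    have himage : RealArray.mixHomeomorph I hU Y = (RealArray.slice Y 0, RealArray.slice Y 1) := by
      refine Prod.ext ?_ ?_
      · exact (RealArray.slice_mix 1 Y 0).trans (by simp)
      · exact (RealArray.slice_mix 1 Y 1).trans (by simp)
    have hp : pencilPoly (RealArray.slice Y 0) (RealArray.slice Y 1) = 0 := by
      refine Polynomial.funext fun s => ?_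
      have := hno _ (RealArray.det_fin_two_of_neg_one_one_ne_zero s)
      rw [RealArray.slice_mix] at this
      rw [eval_pencilPoly, eval_zero, ← this]
      simp [sub_eq_add_neg]
    rw [RealArray.IsBoundaryPoint, ← RealArray.mixHomeomorph_preimage I hU,
      ← Homeomorph.preimage_frontier, Set.mem_preimage, himage, frontier_eq_closure_inter_closure]
    exact ⟨mem_closure_of_triangularizable (triangularizable_of_splits _ _ (Or.inl hp)),
      mem_closure_compl_of_singular hI hp⟩
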